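/- Let $X$ be a nonempty compact complex manifold (Hausdorff, not necessarily connected) of complex dimension $n$, and let $J$ be the complex structure induced on its real tangent bundle $TX$. A Kähler metric on $X$ is a smooth Riemannian metric $g$ on $X$ such that $g(Ju,Jv)=g(u,v)$ for all tangent vectors $u,v$ at the same point and such that the fundamental $2$-form $\omega=g(J\cdot,\cdot)$ is closed, $d\omega=0$. If $X$ admits a Kähler metric, then $$H^{2k}(X,\mathbb{R})\neq 0\qquad\text{for every } k=0,1,\dots,n,$$ where $H^{j}(X,\mathbb{R})=\ker\big(d:\mathcal A^{j}(X)\to\mathcal A^{j+1}(X)\big)\big/\,d\,\mathcal A^{j-1}(X)$ is the de Rham cohomology of the real smooth differential forms on $X$ (with $\mathcal A^{-1}(X)=0$). -/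

import Mathlib

open scoped Manifold ContDiff Topology

noncomputable section

/-! ### Differential forms and de Rham cohomology of a smooth manifold -/

namespace DeRham

variable {E : Type*} [NormedAddCommGroup E] [NormedSpace ℝ E]
  {X : Type*} [TopologicalSpace X] [ChartedSpace E X] {k : ℕ}

variable (E X k) in
/-- A (not necessarily smooth) real differential `k`-form on `X`: the choice of an alternating
`k`-linear form on each tangent space. -/
def RawForm : Type _ := (x : X) → (TangentSpace 𝓘(ℝ, E) x) [⋀^Fin k]→L[ℝ] ℝ

instance : AddCommGroup (RawForm E X k) :=
  inferInstanceAs (AddCommGroup ((x : X) → (TangentSpace 𝓘(ℝ, E) x) [⋀^Fin k]→L[ℝ] ℝ))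

instance : Module ℝ (RawForm E X k) :=
  inferInstanceAs (Module ℝ ((x : X) → (TangentSpace 𝓘(ℝ, E) x) [⋀^Fin k]→L[ℝ] ℝ))

/-- The expression of a `k`-form in a chart `e`, i.e. its pullback under `e⁻¹` to a `k`-form on the
model space. It is meaningful on the open set `e.target`. -/
def inChart (e : OpenPartialHomeomorph X E) (α : RawForm E X k) (y : E) : E [⋀^Fin k]→L[ℝ] ℝ :=
  (α (e.symm y)).compContinuousLinearMap (mfderiv 𝓘(ℝ, E) 𝓘(ℝ, E) e.symm y)

/-- A form is smooth if its expression in every chart of the atlas is smooth. -/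
def IsSmooth (α : RawForm E X k) : Prop :=
  ∀ e ∈ atlas E X, ContDiffOn ℝ ∞ (inChart e α) e.target

/-- The exterior derivative `dα`: at `x`, take a chart `e` around `x`, and pull back by `e` the
exterior derivative of the expression of `α` in that chart. -/
def extD (α : RawForm E X k) : RawForm E X (k + 1) := fun x ↦
  (extDeriv (inChart (chartAt E x) α) (chartAt E x x)).compContinuousLinearMap
    (mfderiv 𝓘(ℝ, E) 𝓘(ℝ, E) (chartAt E x) x)

lemma inChart_add (e : OpenPartialHomeomorph X E) (α β : RawForm E X k) :
    inChart e (α + β) = inChart e α + inChart e β := rfl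

lemma inChart_smul (e : OpenPartialHomeomorph X E) (c : ℝ) (α : RawForm E X k) :
    inChart e (c • α) = c • inChart e α := rfl

lemma inChart_zero (e : OpenPartialHomeomorph X E) :
    inChart e (0 : RawForm E X k) = 0 := rfl

lemma IsSmooth.differentiableAt {α : RawForm E X k} (hα : IsSmooth α) (x : X) :
    DifferentiableAt ℝ (inChart (chartAt E x) α) (chartAt E x x) :=
  ((hα _ (chart_mem_atlas E x)).contDiffAt
    ((chartAt E x).open_target.mem_nhds (mem_chart_target E x))).differentiableAt (by simp)

lemma IsSmooth.zero : IsSmooth (0 : RawForm E X k) := fun e _ ↦ by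
  rw [inChart_zero]
  exact contDiffOn_const

lemma IsSmooth.add {α β : RawForm E X k} (hα : IsSmooth α) (hβ : IsSmooth β) :
    IsSmooth (α + β) := fun e he ↦ by
  rw [inChart_add]
  exact (hα e he).add (hβ e he)

lemma IsSmooth.smul {α : RawForm E X k} (hα : IsSmooth α) (c : ℝ) : IsSmooth (c • α) :=
  fun e he ↦ by
    rw [inChart_smul]
    exact (hα e he).const_smul c

lemma extD_add {α β : RawForm E X k} (hα : IsSmooth α) (hβ : IsSmooth β) :
    extD (α + β) = extD α + extD β := by
  funext x
  simp only [extD, inChart_add]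
  rw [extDeriv_add (hα.differentiableAt x) (hβ.differentiableAt x)]
  rfl

lemma extD_smul (c : ℝ) (α : RawForm E X k) : extD (c • α) = c • extD α := by
  funext x
  simp only [extD, inChart_smul]
  rw [extDeriv_smul]
  rfl

lemma extD_zero : extD (0 : RawForm E X k) = 0 := by
  simpa using extD_smul (0 : ℝ) (0 : RawForm E X k)

variable (E X k) in
/-- The space of closed smooth `k`-forms. -/
def closedForms : Submodule ℝ (RawForm E X k) where
  carrier := {α | IsSmooth α ∧ extD α = 0}
  add_mem' hα hβ := ⟨hα.1.add hβ.1, by rw [extD_add hα.1 hβ.1, hα.2, hβ.2, add_zero]⟩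
  zero_mem' := ⟨IsSmooth.zero, extD_zero⟩
  smul_mem' c α hα := ⟨hα.1.smul c, by rw [extD_smul, hα.2, smul_zero]⟩

variable (E X) in
/-- The space of exact `k`-forms `d 𝒜ᵏ⁻¹(X)`, where `𝒜ᵏ⁻¹(X)` is the space of smooth
`(k - 1)`-forms; it is `0` for `k = 0`. -/
def exactForms : (k : ℕ) → Submodule ℝ (RawForm E X k)
  | 0 => ⊥
  | k + 1 =>
    { carrier := {α | ∃ β : RawForm E X k, IsSmooth β ∧ extD β = α}
      add_mem' := by
        rintro _ _ ⟨β, hβ, rfl⟩ ⟨γ, hγ, rfl⟩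
        exact ⟨β + γ, hβ.add hγ, extD_add hβ hγ⟩
      zero_mem' := ⟨0, IsSmooth.zero, extD_zero⟩
      smul_mem' := by
        rintro c _ ⟨β, hβ, rfl⟩
        exact ⟨c • β, hβ.smul c, extD_smul c β⟩ }

variable (E X k) in
/-- The de Rham cohomology `Hᵏ(X, ℝ)`: closed smooth `k`-forms modulo exact ones. -/
abbrev Cohomology : Type _ :=
  (closedForms E X k) ⧸ (exactForms E X k).submoduleOf (closedForms E X k)

end DeRham

/-! ### Kähler metrics on a complex manifold -/

namespace Kahler

variable {E : Type*} [NormedAddCommGroup E] [NormedSpace ℂ E]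
  {X : Type*} [TopologicalSpace X] [ChartedSpace E X]

variable (E X) in
/-- The smooth manifold underlying a complex manifold. -/
instance isManifold_real [IsManifold 𝓘(ℂ, E) ω X] : IsManifold 𝓘(ℝ, E) ∞ X :=
  isManifold_of_contDiffOn _ _ _ fun e e' he he' ↦ by
    have h := (contDiffGroupoid ω 𝓘(ℂ, E)).compatible he he'
    have h' := ((mem_groupoid_of_pregroupoid).1 h).1
    exact (ContDiffOn.restrict_scalars ℝ h').of_le le_top

/-- The complex structure `J_x = (dφ_x)⁻¹ ∘ i ∘ dφ_x` induced on `T_x X`, where `φ` is a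
holomorphic chart around `x`. -/
def J (x : X) : TangentSpace 𝓘(ℝ, E) x →L[ℝ] TangentSpace 𝓘(ℝ, E) x :=
  let dφ : TangentSpace 𝓘(ℝ, E) x →L[ℝ] E := mfderiv 𝓘(ℝ, E) 𝓘(ℝ, E) (chartAt E x) x
  let dφinv : E →L[ℝ] TangentSpace 𝓘(ℝ, E) x :=
    mfderiv 𝓘(ℝ, E) 𝓘(ℝ, E) (chartAt E x).symm (chartAt E x x)
  let i : E →L[ℝ] E := Complex.I • ContinuousLinearMap.id ℝ E
  dφinv ∘L i ∘L dφ

variable [IsManifold 𝓘(ℂ, E) ω X]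

lemma mfderiv_chartAt_self (x : X) :
    mfderiv 𝓘(ℝ, E) 𝓘(ℝ, E) (chartAt E x) x = ContinuousLinearMap.id ℝ E := by
  have h := mfderiv_extChartAt_self (I := 𝓘(ℝ, E)) (x := x)
  simp only [mfld_simps] at h
  exact h

lemma mfderiv_chartAt_symm_self (x : X) :
    mfderiv 𝓘(ℝ, E) 𝓘(ℝ, E) (chartAt E x).symm (chartAt E x x) = ContinuousLinearMap.id ℝ E := by
  have h := mfderivWithin_range_extChartAt_symm (I := 𝓘(ℝ, E)) (x := x)
  simp only [mfld_simps, mfderivWithin_univ] at h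
  exact h

lemma J_apply (x : X) (v : E) : (J (E := E) x v : E) = Complex.I • v := by
  unfold J
  rw [mfderiv_chartAt_self, mfderiv_chartAt_symm_self]
  rfl

lemma J_J (x : X) (v : TangentSpace 𝓘(ℝ, E) x) : J x (J x v) = -v := by
  have h (w : E) : Complex.I • Complex.I • w = -w := by
    rw [smul_smul, Complex.I_mul_I, neg_one_smul]
  exact (J_apply (E := E) x (J x v)).trans
    ((congrArg (fun w : E ↦ Complex.I • w) (J_apply (E := E) x v)).trans (h v))

variable (E X) in
/-- Smooth Riemannian metrics on the smooth manifold underlying `X`. -/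
abbrev RiemannianMetric : Type _ :=
  Bundle.ContMDiffRiemannianMetric 𝓘(ℝ, E) ∞ E (fun x : X ↦ TangentSpace 𝓘(ℝ, E) x)

/-- A Riemannian metric is Hermitian if `J` is an isometry. -/
def IsHermitian (g : RiemannianMetric E X) : Prop :=
  ∀ (x : X) (u v : TangentSpace 𝓘(ℝ, E) x), g.inner x (J x u) (J x v) = g.inner x u v

lemma IsHermitian.inner_J_self {g : RiemannianMetric E X} (hg : IsHermitian g) (x : X)
    (v : TangentSpace 𝓘(ℝ, E) x) : g.inner x (J x v) v = 0 := by
  have h := hg x (J x v) v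
  rw [J_J, map_neg, neg_apply, g.symm] at h
  linarith

/-- The fundamental form `ω = g(J·, ·)` of a Hermitian metric `g`. -/
def fundamentalForm (g : RiemannianMetric E X) (hg : IsHermitian g) : DeRham.RawForm E X 2 :=
  fun x ↦
    { toFun v := g.inner x (J x (v 0)) (v 1)
      map_update_add' := by
        intro _ v i a b
        fin_cases i <;> simp
      map_update_smul' := by
        intro _ v i c a
        fin_cases i <;> simp
      cont := by
        let G : E →L[ℝ] E →L[ℝ] ℝ := g.inner x
        let J' : E →L[ℝ] E := J x
        have h : Continuous fun v : Fin 2 → E ↦ G (J' (v 0)) (v 1) := by fun_prop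
        exact h
      map_eq_zero_of_eq' := by
        intro v i j hv hij
        have h01 : v 0 = v 1 := by
          fin_cases i <;> fin_cases j <;> simp_all
        rw [h01]
        exact hg.inner_J_self x (v 1) }

lemma fundamentalForm_apply (g : RiemannianMetric E X) (hg : IsHermitian g) (x : X)
    (u v : TangentSpace 𝓘(ℝ, E) x) :
    fundamentalForm g hg x ![u, v] = g.inner x (J x u) v := rfl

/-- A Kähler metric is a Hermitian metric whose fundamental form is closed. -/
def IsKahler (g : RiemannianMetric E X) : Prop :=
  ∃ hg : IsHermitian g, DeRham.extD (fundamentalForm g hg) = 0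

end Kahler
end

/-! The class of `ω ^ k` is the nonzero class. Since `dω = 0`, exterior multiplication by `ω`
commutes with `d` (`extD_twoMul`). Hence every power of `ω` is closed, and if `ω ^ k` with `1 ≤ k ≤
n` were exact, multiplying a primitive by `ω ^ (n - k)` would make `ω ^ n` exact. But `ω ^ n` is
positive on complex-oriented frames, and Stokes forbids a positive exact form of top degree on a
closed oriented manifold (`not_forall_inChart_extD_pos`). For `k = 0` the constant function `1` is
not zero because `X` is nonempty.

Positivity is linear algebra: `ω` comes from a Hermitian inner product, the expansion of `ω ^ n` on
a unitary frame has no negative term (`twoPow_interleave_pos`), and passing to another complex basis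
multiplies the value by the real determinant of a complex-linear map, which is a squared modulus.
The same fact orients the atlas.

Stokes is proved with a partition of unity and no integral over `X`: integrals of pieces supported
in one chart suffice. Products carry a harmless positive factor, `2` per multiplication, so that no
division is needed. -/

set_option maxSynthPendingDepth 3

noncomputable section

/-! ### The product of a `2`-form and a `k`-form -/

namespace ContinuousAlternatingMap

variable {E : Type*} [NormedAddCommGroup E] [NormedSpace ℝ E] {k : ℕ}

variable (E) in
/-- A continuous alternating `2`-form seen as a continuous bilinear form. -/
def toBilin : (E [⋀^Fin 2]→L[ℝ] ℝ) →L[ℝ] E →L[ℝ] E →L[ℝ] ℝ :=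
  ((ofSubsingletonLIE (𝕜 := ℝ) (E := E) (F := ℝ) (0 : Fin 1)).symm.toContinuousLinearEquiv.toContinuousLinearMap.postcomp
    E) ∘L (curryLeftLI (𝕜 := ℝ) (E := E) (F := ℝ) (n := 1)).toContinuousLinearMap

lemma toBilin_apply (η : E [⋀^Fin 2]→L[ℝ] ℝ) (u v : E) : toBilin E η u v = η ![u, v] := by
  have h (f : E [⋀^Fin 1]→L[ℝ] ℝ) (v : E) :
      (ofSubsingletonLIE (𝕜 := ℝ) (E := E) (F := ℝ) (0 : Fin 1)).symm f v = f ![v] := by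
    obtain ⟨g, rfl⟩ := (ofSubsingletonLIE (𝕜 := ℝ) (E := E) (F := ℝ) (0 : Fin 1)).surjective f
    rw [LinearIsometryEquiv.symm_apply_apply]
    simp [ofSubsingletonLIE]
  exact h (curryLeft η u) v

variable (E) in
/-- The alternating part of a continuous bilinear form. -/
def ofBilin : (E →L[ℝ] E →L[ℝ] ℝ) →L[ℝ] E [⋀^Fin 2]→L[ℝ] ℝ :=
  (1 / 2 : ℝ) • ((alternatizeUncurryFinCLM ℝ E ℝ) ∘L
    ((ofSubsingletonLIE (𝕜 := ℝ) (E := E) (F := ℝ)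
      (0 : Fin 1)).toContinuousLinearEquiv.toContinuousLinearMap.postcomp E))

/-- Alternatizing an already alternating bilinear form doubles it, which the factor `1 / 2` undoes.
This inverse lets smoothness of a 2-form be tested on its bilinear form. -/
lemma ofBilin_toBilin (η : E [⋀^Fin 2]→L[ℝ] ℝ) : ofBilin E (toBilin E η) = η := by
  have h : (ofSubsingletonLIE (𝕜 := ℝ) (E := E) (F := ℝ)
      (0 : Fin 1)).toContinuousLinearEquiv.toContinuousLinearMap ∘L toBilin E η = curryLeft η :=
    ContinuousLinearMap.ext fun u ↦ LinearIsometryEquiv.apply_symm_apply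
      (ofSubsingletonLIE (𝕜 := ℝ) (E := E) (F := ℝ) (0 : Fin 1)) (curryLeft η u)
  have h' : ofBilin E (toBilin E η) = (1 / 2 : ℝ) • alternatizeUncurryFin (curryLeft η) := by
    rw [← h]; rfl
  rw [h', alternatizeUncurryFin_curryLeft]
  module

variable (E k) in
/-- The continuous bilinear map sending `α` and `B` to `(u, v) ↦ B u v • α`. -/
def bilinSMul : (E [⋀^Fin k]→L[ℝ] ℝ) →L[ℝ] (E →L[ℝ] E →L[ℝ] ℝ) →L[ℝ]
    (E →L[ℝ] E →L[ℝ] E [⋀^Fin k]→L[ℝ] ℝ) :=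
  (ContinuousLinearMap.compL ℝ E (E →L[ℝ] ℝ) (E →L[ℝ] E [⋀^Fin k]→L[ℝ] ℝ)) ∘L
    (ContinuousLinearMap.smulRightL ℝ E (E [⋀^Fin k]→L[ℝ] ℝ)).flip

lemma bilinSMul_apply (α : E [⋀^Fin k]→L[ℝ] ℝ) (B : E →L[ℝ] E →L[ℝ] ℝ) (u v : E) :
    bilinSMul E k α B u v = B u v • α := rfl

variable (E k) in
/-- Alternatization of two arguments. -/
def alternatizeTwo : (E →L[ℝ] E →L[ℝ] E [⋀^Fin k]→L[ℝ] ℝ) →L[ℝ] E [⋀^Fin (k + 2)]→L[ℝ] ℝ :=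
  (alternatizeUncurryFinCLM ℝ E ℝ) ∘L ((alternatizeUncurryFinCLM ℝ E ℝ).postcomp E)

lemma alternatizeTwo_apply (T : E →L[ℝ] E →L[ℝ] E [⋀^Fin k]→L[ℝ] ℝ) :
    alternatizeTwo E k T = alternatizeUncurryFin (alternatizeUncurryFinCLM ℝ E ℝ ∘L T) := rfl

/-- `T + T.flip` is symmetric, and alternatizing two symmetric arguments gives zero, as in the proof
of `d ∘ d = 0`. -/
lemma alternatizeTwo_flip (T : E →L[ℝ] E →L[ℝ] E [⋀^Fin k]→L[ℝ] ℝ) :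
    alternatizeTwo E k T.flip = -alternatizeTwo E k T := by
  rw [eq_neg_iff_add_eq_zero, ← map_add, alternatizeTwo_apply]
  refine alternatizeUncurryFin_alternatizeUncurryFinCLM_comp_of_symmetric fun x y ↦ ?_
  simp [add_comm]

variable (E k) in
/-- Alternatization of three arguments. -/
def alternatizeThree : (E →L[ℝ] E →L[ℝ] E →L[ℝ] E [⋀^Fin k]→L[ℝ] ℝ) →L[ℝ]
    E [⋀^Fin (k + 3)]→L[ℝ] ℝ :=
  (alternatizeUncurryFinCLM ℝ E ℝ) ∘L ((alternatizeTwo E k).postcomp E)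

lemma alternatizeThree_apply (T : E →L[ℝ] E →L[ℝ] E →L[ℝ] E [⋀^Fin k]→L[ℝ] ℝ) :
    alternatizeThree E k T = alternatizeUncurryFin (alternatizeTwo E k ∘L T) := rfl

lemma alternatizeThree_eq_neg_of_swap₁₂ {S T : E →L[ℝ] E →L[ℝ] E →L[ℝ] E [⋀^Fin k]→L[ℝ] ℝ}
    (h : ∀ u v w, S u v w = T v u w) : alternatizeThree E k S = -alternatizeThree E k T := by
  obtain rfl : S = T.flip := by ext1 u; ext1 v; ext1 w; exact h u v w
  exact alternatizeTwo_flip (((alternatizeUncurryFinCLM ℝ E ℝ).postcomp E) ∘L T)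

lemma alternatizeThree_eq_neg_of_swap₂₃ {S T : E →L[ℝ] E →L[ℝ] E →L[ℝ] E [⋀^Fin k]→L[ℝ] ℝ}
    (h : ∀ u v w, S u v w = T u w v) : alternatizeThree E k S = -alternatizeThree E k T := by
  rw [alternatizeThree_apply, alternatizeThree_apply, ← alternatizeUncurryFinCLM_apply,
    ← alternatizeUncurryFinCLM_apply, ← map_neg]
  refine congrArg (alternatizeUncurryFinCLM ℝ E ℝ) (ContinuousLinearMap.ext fun u ↦ ?_)
  obtain h' : S u = (T u).flip := by ext1 v; ext1 w; exact h u v w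
  exact (congrArg (alternatizeTwo E k) h').trans (alternatizeTwo_flip _)

/-- A 3-cycle is a product of two transpositions, so the two signs cancel. -/
lemma alternatizeThree_eq_of_cycle {S T : E →L[ℝ] E →L[ℝ] E →L[ℝ] E [⋀^Fin k]→L[ℝ] ℝ}
    (h : ∀ u v w, S u v w = T v w u) : alternatizeThree E k S = alternatizeThree E k T := by
  rw [alternatizeThree_eq_neg_of_swap₁₂ (S := S)
      (T := (ContinuousLinearMap.flipₗᵢ ℝ E E _).toContinuousLinearEquiv.toContinuousLinearMap ∘L T),
    alternatizeThree_eq_neg_of_swap₂₃ (T := T), neg_neg]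
  · intro u v w; rfl
  · intro u v w; exact h u v w

variable (E k) in
/-- Twice the exterior product of a `2`-form and a `k`-form. -/
def twoMul : (E [⋀^Fin k]→L[ℝ] ℝ) →L[ℝ] (E [⋀^Fin 2]→L[ℝ] ℝ) →L[ℝ] E [⋀^Fin (k + 2)]→L[ℝ] ℝ :=
  ((alternatizeTwo E k).postcomp _ ∘L (ContinuousLinearMap.precomp _ (toBilin E))) ∘L bilinSMul E k

lemma twoMul_eq (α : E [⋀^Fin k]→L[ℝ] ℝ) (η : E [⋀^Fin 2]→L[ℝ] ℝ) :
    twoMul E k α η = alternatizeTwo E k (bilinSMul E k α (toBilin E η)) := rfl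

lemma twoMul_apply (α : E [⋀^Fin k]→L[ℝ] ℝ) (η : E [⋀^Fin 2]→L[ℝ] ℝ) (v : Fin (k + 2) → E) :
    twoMul E k α η v = ∑ i : Fin (k + 2), ∑ j : Fin (k + 1), (-1) ^ (i : ℕ) * ((-1) ^ (j : ℕ) *
      (η ![v i, i.removeNth v j] * α (j.removeNth (i.removeNth v)))) := by
  rw [twoMul_eq, alternatizeTwo_apply, alternatizeUncurryFin_apply]
  refine Finset.sum_congr rfl fun i _ ↦ ?_
  rw [ContinuousLinearMap.comp_apply, alternatizeUncurryFinCLM_apply, alternatizeUncurryFin_apply,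
    Finset.smul_sum]
  refine Finset.sum_congr rfl fun j _ ↦ ?_
  simp [bilinSMul_apply, toBilin_apply]

lemma twoMul_compContinuousLinearMap {F : Type*} [NormedAddCommGroup F] [NormedSpace ℝ F]
    (α : E [⋀^Fin k]→L[ℝ] ℝ) (η : E [⋀^Fin 2]→L[ℝ] ℝ) (A : F →L[ℝ] E) :
    (twoMul E k α η).compContinuousLinearMap A =
      twoMul F k (α.compContinuousLinearMap A) (η.compContinuousLinearMap A) := by
  ext v
  simp only [compContinuousLinearMap_apply, twoMul_apply]
  refine Finset.sum_congr rfl fun i _ ↦ Finset.sum_congr rfl fun j _ ↦ ?_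
  congr 4
  ext l
  fin_cases l <;> rfl

/-- The Leibniz rule before alternatization: `S₁` differentiates `α` and `S₂` differentiates `η`.
Closedness of `η` kills the second term. -/
lemma extDeriv_twoMul {α : E → E [⋀^Fin k]→L[ℝ] ℝ} {η : E → E [⋀^Fin 2]→L[ℝ] ℝ} {x : E}
    (hα : DifferentiableAt ℝ α x) (hη : DifferentiableAt ℝ η x) (h : extDeriv η x = 0) :
    extDeriv (fun y ↦ twoMul E k (α y) (η y)) x = twoMul E (k + 1) (extDeriv α x) (η x) := by
  have hd := (((twoMul E k).hasFDerivAt.comp x hα.hasFDerivAt).clm_apply hη.hasFDerivAt).fderiv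
  let S₁ : E →L[ℝ] E →L[ℝ] E →L[ℝ] E [⋀^Fin k]→L[ℝ] ℝ :=
    (bilinSMul E k).flip (toBilin E (η x)) ∘L fderiv ℝ α x
  let S₂ : E →L[ℝ] E →L[ℝ] E →L[ℝ] E [⋀^Fin k]→L[ℝ] ℝ :=
    bilinSMul E k (α x) ∘L toBilin E ∘L fderiv ℝ η x
  have h₁ : extDeriv (fun y ↦ twoMul E k (α y) (η y)) x =
      alternatizeThree E k S₂ + alternatizeThree E k S₁ := by
    rw [extDeriv, alternatizeThree_apply, alternatizeThree_apply, ← alternatizeUncurryFin_add]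
    congr 1
  -- The three cyclic rotations of `S₂` have the same alternatization, and their sum is `dη ⊗ α =
  -- 0`; so three times the alternatization vanishes.
  have h₂ : alternatizeThree E k S₂ = 0 := by
    let C : (E →L[ℝ] E →L[ℝ] E →L[ℝ] E [⋀^Fin k]→L[ℝ] ℝ) →
        (E →L[ℝ] E →L[ℝ] E →L[ℝ] E [⋀^Fin k]→L[ℝ] ℝ) := fun T ↦
      ((ContinuousLinearMap.flipₗᵢ ℝ E E _).toContinuousLinearEquiv.toContinuousLinearMap ∘L T).flip
    have hC T u v w : C T u v w = T v w u := rfl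
    have e₁ : alternatizeThree E k (C S₂) = alternatizeThree E k S₂ :=
      alternatizeThree_eq_of_cycle (hC _)
    have e₂ : alternatizeThree E k (C (C S₂)) = alternatizeThree E k S₂ :=
      (alternatizeThree_eq_of_cycle (hC _)).trans e₁
    have e₃ : S₂ + C S₂ + C (C S₂) = 0 := by
      ext1 u; ext1 v; ext1 w
      have hS u v w : S₂ u v w = fderiv ℝ η x u ![v, w] • α x := by
        rw [← toBilin_apply]; rfl
      have h0 : extDeriv η x ![u, v, w] = 0 := by rw [h]; rfl
      rw [extDeriv, alternatizeUncurryFin_apply] at h0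
      simp only [_root_.add_apply, hC, hS, zero_apply, ← add_smul]
      have hsw : fderiv ℝ η x v ![w, u] = - fderiv ℝ η x v ![u, w] := by
        have := (fderiv ℝ η x v).map_swap ![u, w] (i := 0) (j := 1) (by simp)
        refine Eq.trans ?_ this
        refine congrArg (fderiv ℝ η x v) ?_
        ext i; fin_cases i <;> rfl
      have r0 : Fin.removeNth 0 ![u, v, w] = ![v, w] := by ext i; fin_cases i <;> rfl
      have r1 : Fin.removeNth 1 ![u, v, w] = ![u, w] := by ext i; fin_cases i <;> rfl
      have r2 : Fin.removeNth 2 ![u, v, w] = ![u, v] := by ext i; fin_cases i <;> rfl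
      simp [Fin.sum_univ_three, r0, r1, r2] at h0
      rw [hsw]
      convert zero_smul ℝ (α x)
    have e₄ := congrArg (alternatizeThree E k) e₃
    rw [map_add, map_add, e₁, e₂, (alternatizeThree E k).map_zero] at e₄
    have e₅ : (3 : ℝ) • alternatizeThree E k S₂ = 0 := by
      rw [← e₄]; module
    simpa using e₅
  -- The direction of differentiation moves past both arguments of `η`, an even permutation, so no
  -- sign appears.
  have h₃ : alternatizeThree E k S₁ = twoMul E (k + 1) (extDeriv α x) (η x) := by
    let S₃ : E →L[ℝ] E →L[ℝ] E →L[ℝ] E [⋀^Fin k]→L[ℝ] ℝ :=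
      (ContinuousLinearMap.compL ℝ E ℝ (E →L[ℝ] E [⋀^Fin k]→L[ℝ] ℝ)
        (ContinuousLinearMap.toSpanSingleton ℝ (fderiv ℝ α x))) ∘L toBilin E (η x)
    have e : alternatizeThree E k S₁ = alternatizeThree E k S₃ :=
      alternatizeThree_eq_of_cycle fun u v w ↦ rfl
    rw [e, twoMul_eq, alternatizeTwo_apply, alternatizeThree_apply]
    congr 1
    ext1 u
    simp only [ContinuousLinearMap.comp_apply, alternatizeTwo_apply, alternatizeUncurryFinCLM_apply]
    congr 1
    ext1 v
    simp only [ContinuousLinearMap.comp_apply, alternatizeUncurryFinCLM_apply, bilinSMul_apply]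
    exact alternatizeUncurryFin_smul (toBilin E (η x) u v) (fderiv ℝ α x)
  rw [h₁, h₂, h₃, zero_add]

end ContinuousAlternatingMap

/-! ### Powers of a `2`-form and their values on symplectic frames -/

namespace ContinuousAlternatingMap

variable {E : Type*} [NormedAddCommGroup E] [NormedSpace ℝ E]

/-- The `m`-th power of a `2`-form, up to a positive factor. -/
def twoPow (η : E [⋀^Fin 2]→L[ℝ] ℝ) : (m : ℕ) → E [⋀^Fin (2 * m)]→L[ℝ] ℝ
  | 0 => constOfIsEmpty ℝ E (Fin 0) 1
  | m + 1 => twoMul E (2 * m) (twoPow η m) η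

lemma twoPow_compContinuousLinearMap {F : Type*} [NormedAddCommGroup F] [NormedSpace ℝ F]
    (η : E [⋀^Fin 2]→L[ℝ] ℝ) (A : F →L[ℝ] E) (m : ℕ) :
    (twoPow η m).compContinuousLinearMap A = twoPow (η.compContinuousLinearMap A) m := by
  induction m with
  | zero => rfl
  | succ m ih =>
    rw [twoPow, twoPow, ← ih]
    exact twoMul_compContinuousLinearMap _ _ _

/-- An alternating form of top degree is multiplied by the determinant under pullback. -/
lemma map_comp_eq_det_mul [FiniteDimensional ℝ E] {N : ℕ} (hN : Module.finrank ℝ E = N)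
    (θ : E [⋀^Fin N]→L[ℝ] ℝ) (A : E →ₗ[ℝ] E) (v : Fin N → E) :
    θ (A ∘ v) = LinearMap.det A * θ v := by
  let e : Module.Basis (Fin N) ℝ E := Module.finBasisOfFinrankEq ℝ E hN
  have h (w : Fin N → E) : θ w = θ e * e.det w := by
    have := congrArg (fun f : E [⋀^Fin N]→ₗ[ℝ] ℝ ↦ f w)
      (AlternatingMap.eq_smul_basis_det e θ.toAlternatingMap)
    exact this
  rw [h, h v, e.det_comp]
  ring

/-- The tuple `p₀, q₀, p₁, q₁, …`. -/
def interleave {V : Type*} {n : ℕ} (p q : Fin n → V) (i : Fin (2 * n)) : V :=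
  if (i : ℕ) % 2 = 0 then p ⟨i / 2, by omega⟩ else q ⟨i / 2, by omega⟩

lemma interleave_even {V : Type*} {n : ℕ} (p q : Fin n → V) {a : Fin n} {i : Fin (2 * n)}
    (h : (i : ℕ) = 2 * a) : interleave p q i = p a := by
  rw [interleave, if_pos (by omega)]
  congr 1; ext; simp only; omega

lemma interleave_odd {V : Type*} {n : ℕ} (p q : Fin n → V) {a : Fin n} {i : Fin (2 * n)}
    (h : (i : ℕ) = 2 * a + 1) : interleave p q i = q a := by
  rw [interleave, if_neg (by omega)]
  congr 1; ext; simp only; omega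

/-- Whichever member of the `a`-th pair is removed first, the other one then sits at index `2 * a`;
hence the single hypothesis on `j`. -/
lemma interleave_removeNth {V : Type*} {n : ℕ} (p q : Fin (n + 1) → V) (a : Fin (n + 1))
    (i : Fin (2 * n + 2)) (j : Fin (2 * n + 1)) (hj : (j : ℕ) = 2 * a)
    (hi : (i : ℕ) = 2 * a ∨ (i : ℕ) = 2 * a + 1) :
    j.removeNth (i.removeNth (interleave p q)) =
      interleave (a.removeNth p) (a.removeNth q) := by
  ext1 l
  have hl : ((i.succAbove (j.succAbove l) : Fin (2 * n + 2)) : ℕ) =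
      if (l : ℕ) < 2 * a then (l : ℕ) else l + 2 := by
    simp only [Fin.succAbove, Fin.lt_def]
    split_ifs <;> simp_all <;> omega
  have ha (h : (l : ℕ) / 2 < n) : ((a.succAbove ⟨l / 2, h⟩ : Fin (n + 1)) : ℕ) =
      if (l : ℕ) < 2 * a then (l : ℕ) / 2 else l / 2 + 1 := by
    simp only [Fin.succAbove, Fin.lt_def]
    split_ifs <;> simp_all <;> omega
  simp only [Fin.removeNth, interleave]
  have hmod : ((i.succAbove (j.succAbove l) : Fin (2 * n + 2)) : ℕ) % 2 = (l : ℕ) % 2 := by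
    rw [hl]; split_ifs <;> omega
  rw [hmod]
  have hdiv : ((i.succAbove (j.succAbove l) : Fin (2 * n + 2)) : ℕ) / 2 =
      if (l : ℕ) < 2 * a then (l : ℕ) / 2 else l / 2 + 1 := by
    rw [hl]; split_ifs <;> omega
  split_ifs with h
  · congr 1; ext; rw [ha]; exact hdiv
  · congr 1; ext; rw [ha]; exact hdiv

/-- Induction on `n`, expanding along two arguments. Only the pairs `(p a, q a)` and `(q a, p a)`
contribute. The second carries one sign from its position and one from antisymmetry, so every term
is nonnegative, and the term of `(p 0, q 0)` is positive. -/
lemma twoPow_interleave_pos (η : E [⋀^Fin 2]→L[ℝ] ℝ) {n : ℕ} (p q : Fin n → E)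
    (hp : ∀ a b, η ![p a, p b] = 0) (hq : ∀ a b, η ![q a, q b] = 0)
    (hpq : ∀ a b, a ≠ b → η ![p a, q b] = 0) (hpos : ∀ a, 0 < η ![p a, q a]) :
    0 < twoPow η n (interleave p q) := by
  induction n with
  | zero => exact one_pos
  | succ n ih =>
    have hqp a b : η ![q a, p b] = - η ![p b, q a] := by
      have := η.map_swap ![p b, q a] (i := 0) (j := 1) (by simp)
      refine Eq.trans ?_ this
      refine congrArg η ?_
      ext i; fin_cases i <;> rfl
    have ih' (a : Fin (n + 1)) :
        0 < twoPow η n (interleave (a.removeNth p) (a.removeNth q)) := by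
      refine ih _ _ (fun _ _ ↦ hp _ _) (fun _ _ ↦ hq _ _) (fun b c hbc ↦ hpq _ _ ?_)
        (fun _ ↦ hpos _)
      exact fun h ↦ hbc (Fin.succAbove_right_injective h)
    have key (i : Fin (2 * n + 2)) (j : Fin (2 * n + 1)) :
      0 ≤ (-1 : ℝ) ^ (i : ℕ) * ((-1) ^ (j : ℕ) *
      (η ![interleave p q i, i.removeNth (interleave p q) j] *
        twoPow η n (j.removeNth (i.removeNth (interleave p q))))) := by
      have hm : i.removeNth (interleave p q) j = interleave p q (i.succAbove j) := rfl
      have hij : ((i.succAbove j : Fin (2 * n + 2)) : ℕ) =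
          if (j : ℕ) < i then (j : ℕ) else j + 1 := by
        simp only [Fin.succAbove, Fin.lt_def]
        split_ifs <;> simp_all
      obtain ⟨a, ha⟩ : ∃ a : Fin (n + 1), (i : ℕ) = 2 * a ∨ (i : ℕ) = 2 * a + 1 :=
        ⟨⟨i / 2, by omega⟩, by simp only; omega⟩
      obtain ⟨b, hb⟩ : ∃ b : Fin (n + 1), ((i.succAbove j : Fin (2 * n + 2)) : ℕ) = 2 * b ∨
          ((i.succAbove j : Fin (2 * n + 2)) : ℕ) = 2 * b + 1 :=
        ⟨⟨(i.succAbove j : Fin (2 * n + 2)) / 2, by omega⟩, by simp only; omega⟩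
      have rest (hab : a = b) (hj : (j : ℕ) = 2 * a) :
          0 < twoPow η n (j.removeNth (i.removeNth (interleave p q))) := by
        rw [interleave_removeNth p q a i j hj ha]
        exact ih' a
      rw [hm]
      rcases ha with ha | ha <;> rcases hb with hb | hb
      · rw [interleave_even p q ha, interleave_even p q hb, hp]
        simp
      · rw [interleave_even p q ha, interleave_odd p q hb]
        rcases eq_or_ne a b with rfl | hab
        · have hj : (j : ℕ) = 2 * a := by rw [hij] at hb; split_ifs at hb <;> omega
          have := mul_pos (hpos a) (rest rfl hj)
          simpa [ha, hj] using this.le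
        · rw [hpq a b hab]
          simp
      · rw [interleave_odd p q ha, interleave_even p q hb, hqp]
        rcases eq_or_ne a b with rfl | hab
        · have hj : (j : ℕ) = 2 * a := by rw [hij] at hb; split_ifs at hb <;> omega
          have := mul_pos (hpos a) (rest rfl hj)
          simpa [ha, hj, pow_succ] using this.le
        · rw [hpq b a hab.symm]
          simp
      · rw [interleave_odd p q ha, interleave_odd p q hb, hq]
        simp
    have key0 : 0 < (-1 : ℝ) ^ ((0 : Fin (2 * n + 2)) : ℕ) * ((-1) ^ ((0 : Fin (2 * n + 1)) : ℕ) *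
      (η ![interleave p q 0, Fin.removeNth 0 (interleave p q) 0] *
        twoPow η n (Fin.removeNth 0 (Fin.removeNth 0 (interleave p q))))) := by
      rw [interleave_removeNth p q 0 0 0 (by simp) (by simp)]
      have : η ![interleave p q 0, Fin.removeNth 0 (interleave p q) 0] = η ![p 0, q 0] := by
        rw [interleave_even p q (a := 0) (i := 0) rfl]
        refine congrArg η (congrArg (fun x ↦ ![p 0, x]) ?_)
        exact interleave_odd p q (a := 0) (i := (0 : Fin (2 * n + 2)).succAbove 0) rfl
      rw [this]
      simpa using mul_pos (hpos 0) (ih' 0)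
    rw [twoPow, twoMul_apply]
    refine Finset.sum_pos' (fun i _ ↦ Finset.sum_nonneg fun j _ ↦ key i j)
      ⟨0, Finset.mem_univ _, ?_⟩
    exact Finset.sum_pos' (fun j _ ↦ key 0 j) ⟨0, Finset.mem_univ _, key0⟩

end ContinuousAlternatingMap

/-! ### Unitary bases and positivity of the top power -/

section Hermitian

open ContinuousAlternatingMap Complex

/-- Assuming only an additive group keeps the norm built from `core` apart from any norm that the
space already carries. -/
lemma InnerProductSpace.Core.exists_basis_inner_eq_ite {V : Type*} [AddCommGroup V]
    [Module ℂ V] [FiniteDimensional ℂ V] (core : InnerProductSpace.Core ℂ V) {n : ℕ}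
    (hn : Module.finrank ℂ V = n) :
    ∃ c : Module.Basis (Fin n) ℂ V, ∀ a b, core.inner (c a) (c b) = if a = b then 1 else 0 := by
  let _ : NormedAddCommGroup V := core.toNormedAddCommGroup
  let _ : InnerProductSpace ℂ V := InnerProductSpace.ofCore core.toCore
  let c := (stdOrthonormalBasis ℂ V).reindex (finCongr hn)
  exact ⟨c.toBasis, fun a b ↦ by simpa using orthonormal_iff_ite.1 c.orthonormal a b⟩

/-- A real-valued alternating form that is compatible with the complex structure and tames it has
a unitary basis. -/
lemma exists_unitary_basis {E : Type*} [NormedAddCommGroup E] [NormedSpace ℂ E]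
    [FiniteDimensional ℂ E] {n : ℕ} (hn : Module.finrank ℂ E = n) (η : E [⋀^Fin 2]→L[ℝ] ℝ)
    (hI : ∀ u v, η ![I • u, I • v] = η ![u, v]) (hpos : ∀ u, u ≠ 0 → 0 < η ![u, I • u]) :
    ∃ c : Module.Basis (Fin n) ℂ E, ∀ a b, η ![c a, c b] = 0 ∧
      η ![c a, I • c b] = if a = b then 1 else 0 := by
  set B := toBilin E η with hB
  simp only [← toBilin_apply, ← hB] at hI hpos ⊢
  have hII (u : E) : I • I • u = -u := by rw [smul_smul, I_mul_I, neg_one_smul]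
  have hanti u v : B u v = - B v u := by
    have := η.map_swap ![v, u] (i := 0) (j := 1) (by simp)
    rw [hB, toBilin_apply, toBilin_apply]
    refine Eq.trans ?_ this
    refine congrArg η ?_
    ext i; fin_cases i <;> rfl
  have hIl u v : B (I • u) v = - B u (I • v) := by
    rw [← hI u, hII, map_neg, neg_neg]
  have hsmul (z : ℂ) (u : E) : z • u = z.re • u + z.im • I • u := by
    conv_lhs => rw [← re_add_im z]
    rw [add_smul, mul_smul, Complex.coe_smul, Complex.coe_smul]
  -- The Hermitian product `η(u, I v) + i η(u, v)`, conjugate-linear in `u`. Real and imaginary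
  -- parts of orthonormality are the two claims about the basis.
  let core : InnerProductSpace.Core ℂ E :=
    { inner := fun u v ↦ ⟨B u (I • v), B u v⟩
      conj_inner_symm := fun u v ↦ by
        apply Complex.ext
        · simp only [conj_re]
          rw [hanti, hIl, neg_neg]
        · simp only [conj_im]
          rw [hanti, neg_neg]
      re_inner_nonneg := fun u ↦ by
        rcases eq_or_ne u 0 with rfl | h
        · simp
        · exact (hpos u h).le
      add_left := fun u v w ↦ by
        apply Complex.ext <;> simp
      smul_left := fun u v z ↦ by
        have h1 w : B (z • u) w = z.re * B u w - z.im * B u (I • w) := by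
          rw [hsmul, map_add, _root_.add_apply, map_smul, map_smul, _root_.smul_apply,
            _root_.smul_apply, hIl]
          simp [sub_eq_add_neg]
        apply Complex.ext
        · simp [h1, hII]
        · simp [h1]; ring
      definite := fun u h ↦ by
        by_contra hu
        exact (hpos u hu).ne' (congrArg re h) }
  obtain ⟨c, hc⟩ := core.exists_basis_inner_eq_ite hn
  refine ⟨c, fun a b ↦ ⟨(congrArg im (hc a b)).trans ?_, (congrArg re (hc a b)).trans ?_⟩⟩ <;>
    split_ifs <;> simp

/-- The unitary basis depends on `η`, whereas Stokes needs one constant frame at all points. A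
complex-linear map carries `b` to the unitary basis, and its real determinant is a squared modulus.
-/
lemma twoPow_interleave_basis_pos {E : Type*} [NormedAddCommGroup E] [NormedSpace ℂ E]
    [FiniteDimensional ℂ E] {n : ℕ} (b : Module.Basis (Fin n) ℂ E) (η : E [⋀^Fin 2]→L[ℝ] ℝ)
    (hI : ∀ u v, η ![I • u, I • v] = η ![u, v]) (hpos : ∀ u, u ≠ 0 → 0 < η ![u, I • u]) :
    0 < twoPow η n (interleave b (fun a ↦ I • b a)) := by
  have hn : Module.finrank ℂ E = n := by simp [Module.finrank_eq_card_basis b]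
  obtain ⟨c, hc⟩ := exists_unitary_basis hn η hI hpos
  have h1 : 0 < twoPow η n (interleave c (fun a ↦ I • c a)) := by
    refine twoPow_interleave_pos η _ _ (fun a b ↦ (hc a b).1)
      (fun a b ↦ (hI _ _).trans (hc a b).1) (fun a b hab ↦ ?_) (fun a ↦ ?_)
    · rw [(hc a b).2, if_neg hab]
    · rw [(hc a a).2, if_pos rfl]; exact one_pos
  let A : E ≃ₗ[ℂ] E := b.equiv c (Equiv.refl _)
  have hA : interleave c (fun a ↦ I • c a) =
      (A.toLinearMap.restrictScalars ℝ) ∘ interleave b (fun a ↦ I • b a) := by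
    ext1 i
    simp only [interleave, Function.comp_apply]
    split_ifs <;> simp [A]
  have hN : Module.finrank ℝ E = 2 * n := by rw [finrank_real_of_complex, hn]
  rw [hA, map_comp_eq_det_mul hN, LinearMap.det_restrictScalars] at h1
  refine pos_of_mul_pos_right h1 ?_
  rw [Algebra.norm_complex_apply]
  exact normSq_nonneg _

end Hermitian

/-! ### Forms in charts -/

namespace DeRham

open Set

variable {E : Type*} [NormedAddCommGroup E] [NormedSpace ℝ E]
  {X : Type*} [TopologicalSpace X] [ChartedSpace E X] {k : ℕ}
  {e e' : OpenPartialHomeomorph X E}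

lemma transition_source_mem_nhds {E X : Type*} [TopologicalSpace E] [TopologicalSpace X]
    {e e' : OpenPartialHomeomorph X E} {y : E} (hy : y ∈ e.target) (hy' : e.symm y ∈ e'.source) :
    (e.symm ≫ₕ e').source ∈ 𝓝 y :=
  (e.symm ≫ₕ e').open_source.mem_nhds (by simp [hy, hy'])

/-- The derivative of a chart, seen as an endomorphism of the model space. -/
def dChart (e : OpenPartialHomeomorph X E) (x : X) : E →L[ℝ] E :=
  mfderiv 𝓘(ℝ, E) 𝓘(ℝ, E) e x

/-- The derivative of the inverse of a chart, seen as an endomorphism of the model space. -/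
def dSymm (e : OpenPartialHomeomorph X E) (y : E) : E →L[ℝ] E :=
  mfderiv 𝓘(ℝ, E) 𝓘(ℝ, E) e.symm y

/-- A form as a function with values in the alternating forms on the model space. -/
def RawForm.toFun (α : RawForm E X k) : X → E [⋀^Fin k]→L[ℝ] ℝ := α

/-- A function with values in the alternating forms on the model space, seen as a form. -/
def RawForm.ofFun (α : X → E [⋀^Fin k]→L[ℝ] ℝ) : RawForm E X k := α

lemma RawForm.ext {α β : RawForm E X k} (h : ∀ x, α.toFun x = β.toFun x) : α = β := funext h

lemma inChart_eq (e : OpenPartialHomeomorph X E) (α : RawForm E X k) (y : E) :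
    inChart e α y = (α.toFun (e.symm y)).compContinuousLinearMap (dSymm e y) := rfl

lemma toFun_extD (α : RawForm E X k) (x : X) : (extD α).toFun x =
    (extDeriv (inChart (chartAt E x) α) (chartAt E x x)).compContinuousLinearMap
      (dChart (chartAt E x) x) := rfl

lemma IsSmooth.contDiffAt {α : RawForm E X k} (hα : IsSmooth α) (he : e ∈ atlas E X) {y : E}
    (hy : y ∈ e.target) : ContDiffAt ℝ ∞ (inChart e α) y :=
  (hα e he).contDiffAt (e.open_target.mem_nhds hy)

/-- The product of a function and a form. -/
def smulForm (f : X → ℝ) (α : RawForm E X k) : RawForm E X k := .ofFun fun x ↦ f x • α.toFun x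

lemma toFun_smulForm (f : X → ℝ) (α : RawForm E X k) (x : X) :
    (smulForm f α).toFun x = f x • α.toFun x := rfl

lemma smulForm_sum {ι : Type*} (s : Finset ι) (f : X → ℝ) (α : ι → RawForm E X k) :
    smulForm f (∑ i ∈ s, α i) = ∑ i ∈ s, smulForm f (α i) :=
  map_sum ({ toFun := smulForm f
             map_zero' := RawForm.ext fun x ↦ smul_zero (f x)
             map_add' := fun α β ↦ RawForm.ext fun x ↦ smul_add (f x) (α.toFun x) (β.toFun x) } :
    RawForm E X k →+ RawForm E X k) α s

lemma inChart_smulForm (f : X → ℝ) (α : RawForm E X k) (y : E) :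
    inChart e (smulForm f α) y = f (e.symm y) • inChart e α y := rfl

/-- The form `2 η ∧ α` for a `2`-form `η`. -/
def twoMul (η : RawForm E X 2) (α : RawForm E X k) : RawForm E X (k + 2) := .ofFun fun x ↦
  ContinuousAlternatingMap.twoMul E k (α.toFun x) (η.toFun x)

lemma inChart_twoMul (η : RawForm E X 2) (α : RawForm E X k) (y : E) :
    inChart e (twoMul η α) y = ContinuousAlternatingMap.twoMul E k (inChart e α y) (inChart e η y) :=
  ContinuousAlternatingMap.twoMul_compContinuousLinearMap (α.toFun (e.symm y))
    (η.toFun (e.symm y)) (dSymm e y)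

/-- The powers of a `2`-form, up to positive factors. -/
def twoPow (η : RawForm E X 2) (m : ℕ) : RawForm E X (2 * m) := .ofFun fun x ↦
  ContinuousAlternatingMap.twoPow (η.toFun x) m

lemma inChart_twoPow (η : RawForm E X 2) (m : ℕ) (y : E) :
    inChart e (twoPow η m) y = ContinuousAlternatingMap.twoPow (inChart e η y) m :=
  ContinuousAlternatingMap.twoPow_compContinuousLinearMap (η.toFun (e.symm y)) (dSymm e y) m

lemma twoPow_succ (η : RawForm E X 2) (m : ℕ) : twoPow η (m + 1) = twoMul η (twoPow η m) := rfl

lemma inChart_twoPow_zero (η : RawForm E X 2) :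
    inChart e (twoPow η 0) = fun _ ↦ ContinuousAlternatingMap.constOfIsEmpty ℝ E (Fin 0) 1 :=
  funext fun y ↦ inChart_twoPow η 0 y

lemma IsSmooth.twoMul {η : RawForm E X 2} (hη : IsSmooth η) {α : RawForm E X k}
    (hα : IsSmooth α) : IsSmooth (twoMul η α) := fun e he ↦ by
  have h := (((ContinuousAlternatingMap.twoMul E k).contDiff (n := ∞)).comp_contDiffOn
    (hα e he)).clm_apply (hη e he)
  exact h.congr fun y _ ↦ inChart_twoMul η α y

lemma IsSmooth.twoPow {η : RawForm E X 2} (hη : IsSmooth η) (m : ℕ) : IsSmooth (twoPow η m) := by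
  induction m with
  | zero => exact fun e he ↦ by rw [inChart_twoPow_zero]; exact contDiffOn_const
  | succ m ih => exact hη.twoMul ih

variable [IsManifold 𝓘(ℝ, E) ∞ X]

lemma contDiffOn_transition (he : e ∈ atlas E X) (he' : e' ∈ atlas E X) :
    ContDiffOn ℝ ∞ (e' ∘ e.symm) (e.symm ≫ₕ e').source := by
  have h := (contDiffGroupoid ∞ 𝓘(ℝ, E)).compatible he he'
  have h' : ContDiffOn ℝ ∞ _ _ := ((mem_groupoid_of_pregroupoid).1 h).1
  simpa using h'

lemma contDiffAt_transition (he : e ∈ atlas E X) (he' : e' ∈ atlas E X) {y : E}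
    (hy : y ∈ e.target) (hy' : e.symm y ∈ e'.source) : ContDiffAt ℝ ∞ (e' ∘ e.symm) y :=
  (contDiffOn_transition he he').contDiffAt (transition_source_mem_nhds hy hy')

lemma mdifferentiableAt_symm (he : e ∈ atlas E X) {y : E} (hy : y ∈ e.target) :
    MDifferentiableAt 𝓘(ℝ, E) 𝓘(ℝ, E) e.symm y :=
  mdifferentiableAt_atlas_symm he hy

lemma dChart_comp_dSymm (he : e ∈ atlas E X) (he' : e' ∈ atlas E X) {y : E}
    (hy : y ∈ e.target) (hy' : e.symm y ∈ e'.source) :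
    dChart e' (e.symm y) ∘L dSymm e y = fderiv ℝ (e' ∘ e.symm) y := by
  rw [← mfderiv_eq_fderiv]
  exact (mfderiv_comp y (mdifferentiableAt_atlas he' hy') (mdifferentiableAt_symm he hy)).symm

lemma dSymm_comp_dChart (he : e ∈ atlas E X) {x : X} (hx : x ∈ e.source) :
    dSymm e (e x) ∘L dChart e x = ContinuousLinearMap.id ℝ E := by
  have h := mfderiv_comp (I := 𝓘(ℝ, E)) (I' := 𝓘(ℝ, E)) (I'' := 𝓘(ℝ, E)) x
    (mdifferentiableAt_symm he (e.map_source hx)) (mdifferentiableAt_atlas he hx)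
  have h' : e.symm ∘ e =ᶠ[𝓝 x] id := by
    filter_upwards [e.open_source.mem_nhds hx] with z hz
    simp [hz]
  exact h.symm.trans ((h'.mfderiv_eq (I := 𝓘(ℝ, E)) (I' := 𝓘(ℝ, E))).trans mfderiv_id)

lemma dSymm_eq (he : e ∈ atlas E X) (he' : e' ∈ atlas E X) {y : E}
    (hy : y ∈ e.target) (hy' : e.symm y ∈ e'.source) :
    dSymm e y = dSymm e' (e' (e.symm y)) ∘L fderiv ℝ (e' ∘ e.symm) y := by
  rw [← dChart_comp_dSymm he he' hy hy', ← ContinuousLinearMap.comp_assoc,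
    dSymm_comp_dChart he' hy', ContinuousLinearMap.id_comp]

/-- The expressions of a form in two charts are related by pullback. -/
lemma inChart_eq_pullback (he : e ∈ atlas E X) (he' : e' ∈ atlas E X) (α : RawForm E X k) {y : E}
    (hy : y ∈ e.target) (hy' : e.symm y ∈ e'.source) :
    inChart e α y = (inChart e' α (e' (e.symm y))).compContinuousLinearMap
      (fderiv ℝ (e' ∘ e.symm) y) := by
  rw [inChart_eq, inChart_eq, dSymm_eq he he' hy hy', e'.left_inv hy']
  rfl

lemma inChart_compContinuousLinearMap_dChart (he : e ∈ atlas E X) (α : RawForm E X k) {x : X}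
    (hx : x ∈ e.source) :
    (inChart e α (e x)).compContinuousLinearMap (dChart e x) = α.toFun x := by
  have h : (inChart e α (e x)).compContinuousLinearMap (dChart e x) =
    (α.toFun (e.symm (e x))).compContinuousLinearMap (dSymm e (e x) ∘L dChart e x) := rfl
  rw [h, dSymm_comp_dChart he hx, e.left_inv hx]
  rfl

/-- The exterior derivative may be computed in any chart. -/
lemma inChart_extD {α : RawForm E X k} (hα : IsSmooth α) (he : e ∈ atlas E X) {y : E}
    (hy : y ∈ e.target) : inChart e (extD α) y = extDeriv (inChart e α) y := by
  set c := chartAt E (e.symm y) with hc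
  have hcm : c ∈ atlas E X := chart_mem_atlas E _
  have hy' : e.symm y ∈ c.source := mem_chart_source E _
  have h1 : inChart e (extD α) y = (extDeriv (inChart c α) (c (e.symm y))).compContinuousLinearMap
      (dChart c (e.symm y) ∘L dSymm e y) := rfl
  have h2 : inChart e α =ᶠ[𝓝 y] fun z ↦
      (inChart c α ((c ∘ e.symm) z)).compContinuousLinearMap (fderiv ℝ (c ∘ e.symm) z) := by
    filter_upwards [transition_source_mem_nhds hy hy'] with z hz
    simp only [mfld_simps] at hz
    exact inChart_eq_pullback he hcm α hz.1 hz.2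
  rw [h1, dChart_comp_dSymm he hcm hy hy', h2.extDeriv_eq]
  -- Naturality of `d` under pullback by the transition map.
  refine (extDeriv_pullback (r := ∞) ?_ (contDiffAt_transition he hcm hy hy') ?_).symm
  · exact (hα.contDiffAt hcm (c.map_source hy')).differentiableAt (by simp)
  · rw [minSmoothness_of_isRCLikeNormedField]
    exact WithTop.coe_le_coe.2 le_top

lemma IsSmooth.extD {α : RawForm E X k} (hα : IsSmooth α) : IsSmooth (extD α) := by
  intro e he
  have h : ContDiffOn ℝ ∞ (fun y ↦ ContinuousAlternatingMap.alternatizeUncurryFinCLM ℝ E ℝ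
      (fderiv ℝ (inChart e α) y)) e.target :=
    (ContinuousAlternatingMap.alternatizeUncurryFinCLM ℝ E ℝ).contDiff.comp_contDiffOn
      ((hα e he).fderiv_of_isOpen e.open_target le_rfl)
  exact h.congr fun y hy ↦ inChart_extD hα he hy

lemma contDiffOn_comp_symm {f : X → ℝ} (hf : ContMDiff 𝓘(ℝ, E) 𝓘(ℝ) ∞ f) (he : e ∈ atlas E X) :
    ContDiffOn ℝ ∞ (f ∘ e.symm) e.target :=
  (hf.comp_contMDiffOn (contMDiffOn_symm_of_mem_maximalAtlas
    (IsManifold.subset_maximalAtlas he))).contDiffOn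

lemma IsSmooth.smulForm {f : X → ℝ} (hf : ContMDiff 𝓘(ℝ, E) 𝓘(ℝ) ∞ f) {α : RawForm E X k}
    (hα : IsSmooth α) : IsSmooth (smulForm f α) := fun e he ↦
  (contDiffOn_comp_symm hf he).smul (hα e he)

/-- Serves twice: to show that powers of `η` are closed, and to turn a primitive of one power into a
primitive of the next. -/
lemma extD_twoMul {η : RawForm E X 2} (hη : IsSmooth η) (hη0 : DeRham.extD η = 0)
    {α : RawForm E X k} (hα : IsSmooth α) :
    DeRham.extD (DeRham.twoMul η α) = DeRham.twoMul η (DeRham.extD α) := by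
  refine RawForm.ext fun x ↦ ?_
  have hc := chart_mem_atlas E x
  have hx := mem_chart_target E x
  have h0 : extDeriv (inChart (chartAt E x) η) (chartAt E x x) = 0 := by
    rw [← inChart_extD hη hc hx, hη0]; rfl
  have h1 : inChart (chartAt E x) (DeRham.twoMul η α) = fun y ↦ ContinuousAlternatingMap.twoMul E k
    (inChart (chartAt E x) α y) (inChart (chartAt E x) η y) := funext fun y ↦ inChart_twoMul η α y
  rw [toFun_extD, h1, ContinuousAlternatingMap.extDeriv_twoMul (hα.differentiableAt x)
    (hη.differentiableAt x) h0, ContinuousAlternatingMap.twoMul_compContinuousLinearMap,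
    inChart_compContinuousLinearMap_dChart hc _ (mem_chart_source E x), ← toFun_extD]
  rfl

lemma extD_twoPow {η : RawForm E X 2} (hη : IsSmooth η) (hη0 : DeRham.extD η = 0) (m : ℕ) :
    DeRham.extD (DeRham.twoPow η m) = 0 := by
  induction m with
  | zero =>
    refine RawForm.ext fun x ↦ ?_
    have h : extDeriv (inChart (chartAt E x) (DeRham.twoPow η 0)) (chartAt E x x) = 0 := by
      rw [inChart_twoPow_zero, extDeriv, fderiv_fun_const]
      exact map_zero (ContinuousAlternatingMap.alternatizeUncurryFinCLM ℝ E ℝ)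
    exact (toFun_extD _ x).trans (by rw [h]; rfl)
  | succ m ih =>
    rw [twoPow_succ]
    refine (extD_twoMul hη hη0 (hη.twoPow m)).trans ?_
    rw [ih]
    exact RawForm.ext fun x ↦ congrArg (fun f ↦ f (η.toFun x))
      (map_zero (ContinuousAlternatingMap.twoMul E (2 * m + 1)))

end DeRham

/-! ### Stokes' theorem on a closed oriented manifold -/

namespace DeRham

open Set MeasureTheory Module

/-! ### Stokes' theorem for compactly supported forms on a vector space -/

section LocalStokes

variable {E : Type*} [NormedAddCommGroup E] [NormedSpace ℝ E] [FiniteDimensional ℝ E]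
  [MeasurableSpace E] [BorelSpace E] (μ : Measure E) [μ.IsAddHaarMeasure]

lemma integral_fderiv_apply_eq_zero {f : E → ℝ} (hf : ContDiff ℝ 1 f) (hc : HasCompactSupport f)
    (v : E) : ∫ x, fderiv ℝ f x v ∂μ = 0 := by
  have hc' : HasCompactSupport fun x ↦ fderiv ℝ f x v :=
    (hc.fderiv ℝ).comp_left (g := fun L : E →L[ℝ] ℝ ↦ L v) rfl
  have hcont : Continuous fun x ↦ fderiv ℝ f x v :=
    (hf.continuous_fderiv one_ne_zero).clm_apply continuous_const
  -- Integration by parts against the constant function `1`.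
  have h := integral_mul_fderiv_eq_neg_fderiv_mul_of_integrable (μ := μ) (f := fun _ ↦ (1 : ℝ))
    (g := f) (v := v) (by simp) (by simpa using hcont.integrable_of_hasCompactSupport hc')
    (by simpa using hf.continuous.integrable_of_hasCompactSupport hc) (by fun_prop)
    (fun x _ ↦ hf.differentiable one_ne_zero x)
  simpa using h

/-- On a constant frame, `dβ` is an alternating sum of directional derivatives of compactly
supported functions. -/
lemma integral_extDeriv_apply_eq_zero {k : ℕ} {β : E → E [⋀^Fin k]→L[ℝ] ℝ} (hβ : ContDiff ℝ 1 β)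
    (hc : HasCompactSupport β) (v : Fin (k + 1) → E) : ∫ x, extDeriv β x v ∂μ = 0 := by
  have hev (w : Fin k → E) : ContDiff ℝ 1 fun x ↦ β x w :=
    (ContinuousAlternatingMap.apply ℝ E ℝ w).contDiff.comp hβ
  have hcs (w : Fin k → E) : HasCompactSupport fun x ↦ β x w :=
    hc.comp_left (g := fun L : E [⋀^Fin k]→L[ℝ] ℝ ↦ L w) rfl
  simp_rw [fun x ↦ extDeriv_apply (hβ.differentiable one_ne_zero x) v]
  rw [integral_finsetSum]
  · refine Finset.sum_eq_zero fun i _ ↦ ?_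
    simp_rw [zsmul_eq_mul]
    rw [integral_const_mul, integral_fderiv_apply_eq_zero μ (hev _) (hcs _), mul_zero]
  · intro i _
    simp_rw [zsmul_eq_mul]
    refine Integrable.const_mul (Continuous.integrable_of_hasCompactSupport ?_ ?_) _
    · exact ((hev _).continuous_fderiv one_ne_zero).clm_apply continuous_const
    · exact ((hcs _).fderiv ℝ).comp_left (g := fun L : E →L[ℝ] ℝ ↦ L (v i)) rfl

end LocalStokes

variable {E : Type*} [NormedAddCommGroup E] [NormedSpace ℝ E]
  {X : Type*} [TopologicalSpace X] [ChartedSpace E X] {k : ℕ} {e e' : OpenPartialHomeomorph X E}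

/-- The expression of a form in a chart, extended by zero. -/
def chartForm (e : OpenPartialHomeomorph X E) (α : RawForm E X k) : E → E [⋀^Fin k]→L[ℝ] ℝ :=
  e.target.indicator (inChart e α)

lemma inChart_sum {ι : Type*} (s : Finset ι) (α : ι → RawForm E X k) (y : E) :
    inChart e (∑ i ∈ s, α i) y = ∑ i ∈ s, inChart e (α i) y :=
  map_sum ({ toFun := fun α ↦ inChart e α y, map_zero' := rfl, map_add' := fun _ _ ↦ rfl } :
    RawForm E X k →+ E [⋀^Fin k]→L[ℝ] ℝ) α s

lemma chartForm_sum {ι : Type*} (s : Finset ι) (α : ι → RawForm E X k) (y : E) :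
    chartForm e (∑ i ∈ s, α i) y = ∑ i ∈ s, chartForm e (α i) y := by
  by_cases hy : y ∈ e.target
  · simp [chartForm, hy, inChart_sum]
  · simp [chartForm, hy]

lemma IsSmooth.sum {ι : Type*} (s : Finset ι) {α : ι → RawForm E X k}
    (h : ∀ i ∈ s, IsSmooth (α i)) : IsSmooth (∑ i ∈ s, α i) :=
  Finset.sum_induction _ _ (fun _ _ ↦ IsSmooth.add) IsSmooth.zero h

lemma extD_sum {ι : Type*} (s : Finset ι) {α : ι → RawForm E X k}
    (h : ∀ i ∈ s, IsSmooth (α i)) : extD (∑ i ∈ s, α i) = ∑ i ∈ s, extD (α i) := by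
  classical
  induction s using Finset.induction_on with
  | empty => exact extD_zero
  | insert i s hi ih =>
    rw [Finset.sum_insert hi, Finset.sum_insert hi, extD_add (h i (by simp))
      (IsSmooth.sum s fun j hj ↦ h j (by simp [hj])), ih fun j hj ↦ h j (by simp [hj])]

lemma inChart_eq_zero {α : RawForm E X k} {y : E} (h : α.toFun (e.symm y) = 0) :
    inChart e α y = 0 := by
  rw [inChart_eq, h]; rfl

lemma extD_eq_zero_of_notMem {K : Set X} (hK : IsClosed K) {α : RawForm E X k}
    (h : ∀ x ∉ K, α.toFun x = 0) : ∀ x ∉ K, (extD α).toFun x = 0 := by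
  intro x hx
  set c := chartAt E x
  have h0 : inChart c α =ᶠ[𝓝 (c x)] fun _ ↦ 0 := by
    have hcont : ContinuousAt c.symm (c x) :=
      c.continuousAt_symm (c.map_source (mem_chart_source E x))
    have : Kᶜ ∈ 𝓝 (c.symm (c x)) := by
      rw [c.left_inv (mem_chart_source E x)]
      exact hK.isOpen_compl.mem_nhds hx
    filter_upwards [hcont.preimage_mem_nhds this] with y hy
    exact inChart_eq_zero (h _ hy)
  have h1 : extDeriv (inChart c α) (c x) = 0 := by
    rw [h0.extDeriv_eq, extDeriv, fderiv_fun_const]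
    exact map_zero (ContinuousAlternatingMap.alternatizeUncurryFinCLM ℝ E ℝ)
  rw [toFun_extD, h1]; rfl

/-! ### Forms with compact support in one chart -/

section CompactSupport

variable {K : Set X} (hK : IsCompact K) (hKe : K ⊆ e.source) {α : RawForm E X k}
  (hα : ∀ x ∉ K, α.toFun x = 0)
include hα

lemma chartForm_eq_zero_of_notMem {y : E} (hy : y ∉ e '' K) : chartForm e α y = 0 := by
  by_cases hyt : y ∈ e.target
  · rw [chartForm, indicator_of_mem hyt]
    exact inChart_eq_zero (hα _ fun h ↦ hy ⟨_, h, e.right_inv hyt⟩)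
  · rw [chartForm, indicator_of_notMem hyt]

include hK hKe

lemma hasCompactSupport_chartForm : HasCompactSupport (chartForm e α) :=
  HasCompactSupport.intro (hK.image_of_continuousOn (e.continuousOn.mono hKe))
    fun _ hy ↦ chartForm_eq_zero_of_notMem hα hy

/-- The image of `K` is compact, hence closed in `E`, and lies in the target. This is what makes the
extension by zero smooth. -/
lemma chartForm_eventuallyEq_zero {y : E} (hy : y ∉ e.target) :
    chartForm e α =ᶠ[𝓝 y] fun _ ↦ 0 := by
  have hcl : IsClosed (e '' K) :=
    (hK.image_of_continuousOn (e.continuousOn.mono hKe)).isClosed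
  have hy' : y ∉ e '' K := by
    rintro ⟨x, hx, rfl⟩
    exact hy (e.map_source (hKe hx))
  filter_upwards [hcl.isOpen_compl.mem_nhds hy'] with z hz
  exact chartForm_eq_zero_of_notMem hα hz

lemma contDiff_chartForm (he : e ∈ atlas E X) (hs : IsSmooth α) :
    ContDiff ℝ ∞ (chartForm e α) := by
  refine contDiff_iff_contDiffAt.2 fun y ↦ ?_
  by_cases hy : y ∈ e.target
  · exact (hs.contDiffAt he hy).congr_of_eventuallyEq
      ((e.open_target.mem_nhds hy) |> Filter.eventually_of_mem <| fun z hz ↦ indicator_of_mem hz _)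
  · exact contDiffAt_const.congr_of_eventuallyEq (chartForm_eventuallyEq_zero hK hKe hα hy)

lemma extDeriv_chartForm [IsManifold 𝓘(ℝ, E) ∞ X] (he : e ∈ atlas E X) (hs : IsSmooth α) :
    extDeriv (chartForm e α) = chartForm e (extD α) := by
  funext y
  by_cases hy : y ∈ e.target
  · have h : chartForm e α =ᶠ[𝓝 y] inChart e α :=
      Filter.eventually_of_mem (e.open_target.mem_nhds hy) fun z hz ↦ indicator_of_mem hz _
    rw [h.extDeriv_eq, chartForm, indicator_of_mem hy, inChart_extD hs he hy]
  · rw [(chartForm_eventuallyEq_zero hK hKe hα hy).extDeriv_eq, chartForm, indicator_of_notMem hy,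
      extDeriv, fderiv_fun_const]
    exact map_zero (ContinuousAlternatingMap.alternatizeUncurryFinCLM ℝ E ℝ)

variable [MeasurableSpace E] [BorelSpace E] (μ : Measure E)

lemma integrable_chartForm_apply [IsFiniteMeasureOnCompacts μ] (he : e ∈ atlas E X)
    (hs : IsSmooth α) (v : Fin k → E) : Integrable (fun y ↦ chartForm e α y v) μ := by
  refine Continuous.integrable_of_hasCompactSupport ?_ ?_
  · exact (ContinuousAlternatingMap.apply ℝ E ℝ v).continuous.comp
      (contDiff_chartForm hK hKe hα he hs).continuous
  · exact (hasCompactSupport_chartForm hK hKe hα).comp_left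
      (g := fun L : E [⋀^Fin k]→L[ℝ] ℝ ↦ L v) rfl

lemma integral_chartForm_extD_eq_zero [FiniteDimensional ℝ E] [μ.IsAddHaarMeasure]
    [IsManifold 𝓘(ℝ, E) ∞ X] (he : e ∈ atlas E X) (hs : IsSmooth α) (v : Fin (k + 1) → E) :
    ∫ y, chartForm e (extD α) y v ∂μ = 0 := by
  rw [← extDeriv_chartForm hK hKe hα he hs]
  exact integral_extDeriv_apply_eq_zero μ ((contDiff_chartForm hK hKe hα he hs).of_le
    (by exact_mod_cast le_top)) (hasCompactSupport_chartForm hK hKe hα) v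

end CompactSupport

/-! ### Change of chart and the global Stokes argument -/

variable (E X) in
/-- The transition maps between any two charts in the atlas preserve the orientation. -/
def IsOrientedAtlas : Prop := ∀ e ∈ atlas E X, ∀ e' ∈ atlas E X, ∀ y ∈ (e.symm ≫ₕ e').source,
  0 < (fderiv ℝ (e' ∘ e.symm) y).det

lemma integral_chartForm [MeasurableSpace E] [BorelSpace E] (μ : Measure E)
    (e : OpenPartialHomeomorph X E) (θ : RawForm E X k) (v : Fin k → E) :
    ∫ y, chartForm e θ y v ∂μ = ∫ y in e.target, inChart e θ y v ∂μ := by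
  rw [← integral_indicator e.open_target.measurableSet]
  congr 1
  funext y
  by_cases hy : y ∈ e.target <;> simp [chartForm, hy]

variable [FiniteDimensional ℝ E] [IsManifold 𝓘(ℝ, E) ∞ X]

/-- The integral of a top-degree form does not depend on the chart. -/
lemma integral_chartForm_eq [MeasurableSpace E] [BorelSpace E] (μ : Measure E)
    [μ.IsAddHaarMeasure] (hor : IsOrientedAtlas E X) (hk : finrank ℝ E = k)
    (he : e ∈ atlas E X) (he' : e' ∈ atlas E X) {θ : RawForm E X k}
    (hθ : ∀ x ∉ e.source ∩ e'.source, θ.toFun x = 0) (v : Fin k → E) :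
    ∫ y, chartForm e θ y v ∂μ = ∫ y, chartForm e' θ y v ∂μ := by
  set τ := e.symm ≫ₕ e' with hτ
  -- By the support hypothesis both integrals live on the overlap of the charts.
  have hsub {e e' : OpenPartialHomeomorph X E}
      (hθ : ∀ x ∉ e.source ∩ e'.source, θ.toFun x = 0) :
      ∫ y, chartForm e θ y v ∂μ = ∫ y in (e.symm ≫ₕ e').source, inChart e θ y v ∂μ := by
    rw [integral_chartForm]
    refine setIntegral_eq_of_subset_of_forall_sdiff_eq_zero e.open_target.measurableSet ?_ ?_
    · simp
    · intro y hy
      rw [inChart_eq_zero]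
      · rfl
      · refine hθ _ fun h ↦ hy.2 ?_
        simp [hy.1, h.2]
  rw [hsub hθ, hsub (fun x hx ↦ hθ x (by rwa [inter_comm])), ← hτ]
  have himg : (e'.symm ≫ₕ e).source = τ '' τ.source := by
    rw [τ.image_source_eq_target]
    simp [hτ, mfld_simps]
  rw [himg, integral_image_eq_integral_abs_det_fderiv_smul μ τ.open_source.measurableSet
    (f' := fderiv ℝ (e' ∘ e.symm)) _ τ.injOn]
  · refine setIntegral_congr_fun τ.open_source.measurableSet fun y hy ↦ ?_
    have hy' := hy
    simp only [hτ, mfld_simps] at hy'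
    -- Orientation makes the Jacobian `|det|` equal to the factor `det` by which a top form pulls
    -- back.
    rw [abs_of_pos (hor e he e' he' y hy), inChart_eq_pullback he he' θ hy'.1 hy'.2]
    exact ContinuousAlternatingMap.map_comp_eq_det_mul hk (inChart e' θ (e' (e.symm y)))
      (fderiv ℝ (e' ∘ e.symm) y).toLinearMap v
  · intro y hy
    have hy' := hy
    simp only [hτ, mfld_simps] at hy'
    exact ((contDiffAt_transition he he' hy'.1 hy'.2).differentiableAt
      (by simp)).hasFDerivAt.hasFDerivWithinAt

/-- On a closed oriented manifold, an exact form of top degree cannot be positive everywhere. -/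
theorem not_forall_inChart_extD_pos [T2Space X] [CompactSpace X] [Nonempty X]
    (hor : IsOrientedAtlas E X) (hk : finrank ℝ E = k + 1) {β : RawForm E X k} (hβ : IsSmooth β)
    (v : Fin (k + 1) → E) :
    ¬ ∀ e ∈ atlas E X, ∀ y ∈ e.target, 0 < inChart e (extD β) y v := by
  intro hpos
  borelize E
  let μ : Measure E := Measure.addHaar
  obtain ⟨t, -, ht⟩ := isCompact_univ.elim_nhds_subcover (fun x : X ↦ (chartAt E x).source)
    fun x _ ↦ (chartAt E x).open_source.mem_nhds (mem_chart_source E x)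
  obtain ⟨ρ, hρ⟩ := SmoothPartitionOfUnity.exists_isSubordinate 𝓘(ℝ, E) isClosed_univ
    (fun i : t ↦ (chartAt E (i : X)).source) (fun i ↦ (chartAt E (i : X)).open_source)
    (by simpa [iUnion_subtype] using ht)
  have hsum (x : X) : ∑ i, ρ i x = 1 := by
    rw [← finsum_eq_sum_of_fintype]
    exact ρ.sum_eq_one (mem_univ x)
  have hK (i : t) : IsCompact (tsupport (ρ i)) := (isClosed_tsupport _).isCompact
  have h0 (i : t) {m : ℕ} (α : RawForm E X m) :
      ∀ x ∉ tsupport (ρ i), (smulForm (ρ i) α).toFun x = 0 := by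
    intro x hx
    rw [toFun_smulForm, image_eq_zero_of_notMem_tsupport hx, zero_smul]
  have hs (i : t) {m : ℕ} {α : RawForm E X m} (hα : IsSmooth α) : IsSmooth (smulForm (ρ i) α) :=
    hα.smulForm (ρ i).contMDiff
  have hat (i : t) : chartAt E (i : X) ∈ atlas E X := chart_mem_atlas E _
  have hdec {m : ℕ} (α : RawForm E X m) : ∑ i, smulForm (ρ i) α = α := by
    refine RawForm.ext fun x ↦ ?_
    have : (∑ i, smulForm (ρ i) α).toFun x = ∑ i, ρ i x • α.toFun x :=
      Finset.sum_apply x Finset.univ fun i ↦ smulForm (ρ i) α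
    rw [this, ← Finset.sum_smul, hsum, one_smul]
  -- Each `θ i` is exact with support in chart `i`. Cutting it again by `ρ j` gives pieces supported
  -- in two charts, which can be integrated in either.
  set θ : t → RawForm E X (k + 1) := fun i ↦ extD (smulForm (ρ i) β) with hθ
  have hθs (i : t) : IsSmooth (θ i) := (hs i hβ).extD
  have hθ0 (i : t) := extD_eq_zero_of_notMem (isClosed_tsupport _) (h0 i β)
  have hθsum : ∑ i, θ i = extD β := by
    rw [← extD_sum _ fun i _ ↦ hs i hβ, hdec]
  have hzero (i : t) :
      ∑ j, ∫ y, chartForm (chartAt E (i : X)) (smulForm (ρ j) (θ i)) y v ∂μ = 0 := by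
    rw [← integral_finsetSum]
    · rw [← integral_chartForm_extD_eq_zero (hK i) (hρ i) (h0 i β) μ (hat i) (hs i hβ) v]
      congr 1
      funext y
      conv_rhs => rw [← hdec (extD (smulForm (ρ i) β)), chartForm_sum]
      simp [hθ]
    · intro j _
      refine integrable_chartForm_apply (hK i) (hρ i) (fun x hx ↦ ?_) μ (hat i) (hs j (hθs i)) v
      rw [toFun_smulForm, hθ0 i x hx, smul_zero]
  have hchange (i j : t) : ∫ y, chartForm (chartAt E (i : X)) (smulForm (ρ j) (θ i)) y v ∂μ =
      ∫ y, chartForm (chartAt E (j : X)) (smulForm (ρ j) (θ i)) y v ∂μ := by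
    refine integral_chartForm_eq μ hor hk (hat i) (hat j) (fun x hx ↦ ?_) v
    by_cases hxi : x ∈ tsupport (ρ i)
    · exact h0 j _ x fun hxj ↦ hx ⟨hρ i hxi, hρ j hxj⟩
    · rw [toFun_smulForm, hθ0 i x hxi, smul_zero]
  -- This sum plays the role of the integral of `dβ` over `X`. Splitting `dβ` into the `θ i` and
  -- moving each piece from chart `j` to chart `i` reduces it to the local Stokes theorem.
  have htotal :
      ∑ j : t, ∫ y, chartForm (chartAt E (j : X)) (smulForm (ρ j) (extD β)) y v ∂μ = 0 := by
    have h1 (j : t) : ∫ y, chartForm (chartAt E (j : X)) (smulForm (ρ j) (extD β)) y v ∂μ =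
        ∑ i, ∫ y, chartForm (chartAt E (j : X)) (smulForm (ρ j) (θ i)) y v ∂μ := by
      rw [← integral_finsetSum]
      · congr 1
        funext y
        have : smulForm (ρ j) (extD β) = ∑ i, smulForm (ρ j) (θ i) := by
          rw [← hθsum, smulForm_sum]
        rw [this, chartForm_sum]
        simp
      · exact fun i _ ↦ integrable_chartForm_apply (hK j) (hρ j) (h0 j _) μ (hat j)
          (hs j (hθs i)) v
    simp_rw [h1]
    rw [Finset.sum_comm]
    refine Finset.sum_eq_zero fun i _ ↦ ?_
    rw [← hzero i]
    exact Finset.sum_congr rfl fun j _ ↦ (hchange i j).symm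
  have hnn (j : t) (y : E) : 0 ≤ chartForm (chartAt E (j : X)) (smulForm (ρ j) (extD β)) y v := by
    by_cases hy : y ∈ (chartAt E (j : X)).target
    · rw [chartForm, indicator_of_mem hy, inChart_smulForm]
      exact mul_nonneg (ρ.nonneg j _) (hpos _ (hat j) y hy).le
    · simp [chartForm, hy]
  obtain ⟨x⟩ := ‹Nonempty X›
  obtain ⟨j, hj⟩ : ∃ j, 0 < ρ j x := by
    by_contra! h
    have := Finset.sum_nonpos fun i (_ : i ∈ Finset.univ) ↦ h i
    rw [hsum x] at this
    linarith
  refine htotal.not_gt (Finset.sum_pos' (fun i _ ↦ integral_nonneg (hnn i))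
    ⟨j, Finset.mem_univ _, ?_⟩)
  have hxj : x ∈ (chartAt E (j : X)).source :=
    hρ j (subset_tsupport _ (Function.mem_support.2 hj.ne'))
  refine Continuous.integral_pos_of_hasCompactSupport_nonneg_nonzero (x := chartAt E (j : X) x)
    ?_ ?_ (hnn j) ?_
  · exact (ContinuousAlternatingMap.apply ℝ E ℝ v).continuous.comp
      (contDiff_chartForm (hK j) (hρ j) (h0 j _) (hat j) (hs j hβ.extD)).continuous
  · exact (hasCompactSupport_chartForm (hK j) (hρ j) (h0 j _)).comp_left
      (g := fun L : E [⋀^Fin (k + 1)]→L[ℝ] ℝ ↦ L v) rfl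
  · have hy := (chartAt E (j : X)).map_source hxj
    rw [chartForm, indicator_of_mem hy, inChart_smulForm, (chartAt E (j : X)).left_inv hxj]
    exact (mul_pos hj (hpos _ (hat j) _ hy)).ne'

end DeRham

/-! ### The fundamental form of a Kähler metric -/

namespace Kahler

open DeRham Module

variable {E : Type*} [NormedAddCommGroup E] [NormedSpace ℂ E]
  {X : Type*} [TopologicalSpace X] [ChartedSpace E X] [IsManifold 𝓘(ℂ, E) ω X]
  {e e' : OpenPartialHomeomorph X E}

lemma differentiableAt_transition (he : e ∈ atlas E X) (he' : e' ∈ atlas E X) {y : E}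
    (hy : y ∈ e.target) (hy' : e.symm y ∈ e'.source) :
    DifferentiableAt ℂ (e' ∘ e.symm) y := by
  have h := (contDiffGroupoid ω 𝓘(ℂ, E)).compatible he he'
  have h' : ContDiffOn ℂ ω _ _ := ((mem_groupoid_of_pregroupoid).1 h).1
  have h'' : ContDiffOn ℂ ω (e' ∘ e.symm) (e.symm ≫ₕ e').source := by simpa using h'
  exact (h''.contDiffAt (transition_source_mem_nhds hy hy')).differentiableAt (by simp)

lemma fderiv_transition (he : e ∈ atlas E X) (he' : e' ∈ atlas E X) {y : E}
    (hy : y ∈ e.target) (hy' : e.symm y ∈ e'.source) :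
    fderiv ℝ (e' ∘ e.symm) y = (fderiv ℂ (e' ∘ e.symm) y).restrictScalars ℝ :=
  ((differentiableAt_transition he he' hy hy').hasFDerivAt.restrictScalars ℝ).fderiv

lemma dSymm_chartAt (x : X) : dSymm (chartAt E x) (chartAt E x x) = ContinuousLinearMap.id ℝ E :=
  mfderiv_chartAt_symm_self (E := E) x

/-- The tangent space at a point is identified with `E` through its preferred chart, so `dSymm e y`
is the derivative of a holomorphic transition map. -/
lemma dSymm_I_smul (he : e ∈ atlas E X) {y : E} (hy : y ∈ e.target) (u : E) :
    dSymm e y (Complex.I • u) = Complex.I • dSymm e y u := by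
  rw [dSymm_eq he (chart_mem_atlas E (e.symm y)) hy (mem_chart_source E _), dSymm_chartAt,
    fderiv_transition he (chart_mem_atlas E (e.symm y)) hy (mem_chart_source E _)]
  simp

lemma dSymm_injective (he : e ∈ atlas E X) {y : E} (hy : y ∈ e.target) :
    Function.Injective (dSymm e y) := by
  have h1 := dChart_comp_dSymm he he hy (e.map_target hy)
  have h2 : e ∘ e.symm =ᶠ[𝓝 y] id := by
    filter_upwards [e.open_target.mem_nhds hy] with z hz
    simp [hz]
  rw [h2.fderiv_eq, fderiv_id] at h1
  exact Function.LeftInverse.injective (g := dChart e (e.symm y)) fun u ↦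
    congrArg (fun L : E →L[ℝ] E ↦ L u) h1

/-- The derivative of a transition map is injective and complex-linear, so its real determinant is
nonzero and a squared modulus. -/
lemma isOrientedAtlas [FiniteDimensional ℂ E] : IsOrientedAtlas E X := by
  intro e he e' he' y hy
  simp only [mfld_simps] at hy
  have hdet : (fderiv ℝ (e' ∘ e.symm) y).det ≠ 0 := by
    have h1 := dSymm_eq he he' hy.1 hy.2
    have hinj : Function.Injective (fderiv ℝ (e' ∘ e.symm) y) := by
      have := dSymm_injective he hy.1
      rw [h1] at this
      exact Function.Injective.of_comp (f := dSymm e' (e' (e.symm y))) this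
    have := LinearMap.isUnit_iff_ker_eq_bot (fderiv ℝ (e' ∘ e.symm) y).toLinearMap
    exact ((this.2 (LinearMap.ker_eq_bot.2 hinj)).map LinearMap.det).ne_zero
  refine lt_of_le_of_ne ?_ hdet.symm
  rw [fderiv_transition he he' hy.1 hy.2]
  have : ((fderiv ℂ (e' ∘ e.symm) y).restrictScalars ℝ).det =
    LinearMap.det ((fderiv ℂ (e' ∘ e.symm) y).toLinearMap.restrictScalars ℝ) := rfl
  rw [this, LinearMap.det_restrictScalars, Algebra.norm_complex_apply]
  exact Complex.normSq_nonneg _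

variable (g : RiemannianMetric E X) (hg : IsHermitian g)

/-- A Riemannian metric in a chart. -/
def metricInChart (e : OpenPartialHomeomorph X E) (y u v : E) : ℝ :=
  g.inner (e.symm y) (show TangentSpace 𝓘(ℝ, E) (e.symm y) from dSymm e y u)
    (show TangentSpace 𝓘(ℝ, E) (e.symm y) from dSymm e y v)

lemma contDiffOn_metricInChart (he : e ∈ atlas E X) (u v : E) :
    ContDiffOn ℝ ∞ (fun y ↦ metricInChart g e y u v) e.target := by
  have hsymm : ContMDiffOn 𝓘(ℝ, E) 𝓘(ℝ, E) ∞ e.symm e.target :=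
    contMDiffOn_symm_of_mem_maximalAtlas (IsManifold.subset_maximalAtlas he)
  -- The metric is smooth as a bundle section, so constant vectors must first become smooth fields
  -- along `e.symm`: they are images of constant sections under its tangent map.
  have hvec (w : E) : ContMDiffOn 𝓘(ℝ, E) (𝓘(ℝ, E).prod 𝓘(ℝ, E)) ∞ (fun y ↦
      Bundle.TotalSpace.mk' E (E := fun x : X ↦ TangentSpace 𝓘(ℝ, E) x) (e.symm y)
        (show TangentSpace 𝓘(ℝ, E) (e.symm y) from dSymm e y w)) e.target := by
    have h1 : ContMDiffOn 𝓘(ℝ, E) (𝓘(ℝ, E).prod 𝓘(ℝ, E)) ∞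
        (fun y : E ↦ (⟨y, w⟩ : TangentBundle 𝓘(ℝ, E) E)) e.target :=
      contMDiffOn_vectorSpace_iff_contDiffOn.2 contDiffOn_const
    have h2 := (hsymm.contMDiffOn_tangentMapWithin (m := ∞) (by simp)
      e.open_target.uniqueMDiffOn).comp h1 (fun y hy ↦ hy)
    refine h2.congr fun y hy ↦ ?_
    have h3 : mfderivWithin 𝓘(ℝ, E) 𝓘(ℝ, E) e.symm e.target y =
      mfderiv 𝓘(ℝ, E) 𝓘(ℝ, E) e.symm y := mfderivWithin_of_isOpen e.open_target hy
    simp only [Function.comp_apply, tangentMapWithin, h3]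
    rfl
  have h : ContMDiffOn 𝓘(ℝ, E) (𝓘(ℝ, E).prod 𝓘(ℝ)) ∞ (fun y ↦
      Bundle.TotalSpace.mk' ℝ (E := Bundle.Trivial X ℝ) (e.symm y) (metricInChart g e y u v))
      e.target := by
    apply ContMDiffOn.clm_bundle_apply₂ (F₁ := E) (F₂ := E)
    · exact g.contMDiff.comp_contMDiffOn hsymm
    · exact hvec u
    · exact hvec v
  have h' : ContMDiffOn 𝓘(ℝ, E) 𝓘(ℝ) ∞ (fun y ↦ metricInChart g e y u v) e.target := by
    intro y hy
    have := h y hy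
    rw [Bundle.contMDiffWithinAt_totalSpace] at this
    exact this.2
  exact h'.contDiffOn

lemma inChart_fundamentalForm (he : e ∈ atlas E X) {y : E} (hy : y ∈ e.target) (u v : E) :
    inChart e (fundamentalForm g hg) y ![u, v] = metricInChart g e y (Complex.I • u) v := by
  have h : inChart e (fundamentalForm g hg) y ![u, v] =
    g.inner (e.symm y) (J (e.symm y) (show TangentSpace 𝓘(ℝ, E) (e.symm y) from dSymm e y u))
    (show TangentSpace 𝓘(ℝ, E) (e.symm y) from dSymm e y v) := rfl
  rw [h, metricInChart, dSymm_I_smul he hy]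
  exact congrArg (fun w ↦ g.inner (e.symm y) w
    (show TangentSpace 𝓘(ℝ, E) (e.symm y) from dSymm e y v)) (J_apply (E := E) (e.symm y) _)

include hg in
lemma metricInChart_I_smul (he : e ∈ atlas E X) {y : E} (hy : y ∈ e.target) (u v : E) :
    metricInChart g e y (Complex.I • u) (Complex.I • v) = metricInChart g e y u v := by
  have h := hg (e.symm y) (show TangentSpace 𝓘(ℝ, E) (e.symm y) from dSymm e y u)
    (show TangentSpace 𝓘(ℝ, E) (e.symm y) from dSymm e y v)
  have hJ (w : E) : J (e.symm y) (show TangentSpace 𝓘(ℝ, E) (e.symm y) from dSymm e y w) =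
      (show TangentSpace 𝓘(ℝ, E) (e.symm y) from dSymm e y (Complex.I • w)) :=
    (J_apply (E := E) (e.symm y) _).trans (dSymm_I_smul he hy w).symm
  rw [hJ, hJ] at h
  exact h

lemma metricInChart_pos (he : e ∈ atlas E X) {y : E} (hy : y ∈ e.target) {u : E} (hu : u ≠ 0) :
    0 < metricInChart g e y u u :=
  g.pos (e.symm y) _ fun h ↦ hu (dSymm_injective he hy (h.trans (map_zero (dSymm e y)).symm))

/-- In finite dimension a bilinear form depends smoothly on the point once its values on constant
vectors do; `ofBilin` then recovers the alternating form. -/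
lemma isSmooth_fundamentalForm [FiniteDimensional ℂ E] : IsSmooth (fundamentalForm g hg) := by
  intro e he
  let B : E → E →L[ℝ] E →L[ℝ] ℝ := fun y ↦
    ContinuousAlternatingMap.toBilin E (inChart e (fundamentalForm g hg) y)
  have hB : ContDiffOn ℝ ∞ B e.target := by
    refine contDiffOn_clm_apply.2 fun u ↦ contDiffOn_clm_apply.2 fun v ↦ ?_
    refine (contDiffOn_metricInChart g he (Complex.I • u) v).congr fun y hy ↦ ?_
    exact (ContinuousAlternatingMap.toBilin_apply _ _ _).trans
      (inChart_fundamentalForm g hg he hy u v)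
  have h := ((ContinuousAlternatingMap.ofBilin E).contDiff (n := ∞)).comp_contDiffOn hB
  exact h.congr fun y _ ↦ (ContinuousAlternatingMap.ofBilin_toBilin _).symm

lemma inChart_twoPow_fundamentalForm_pos [FiniteDimensional ℂ E] {n : ℕ}
    (b : Basis (Fin n) ℂ E) (he : e ∈ atlas E X) {y : E} (hy : y ∈ e.target) :
    0 < inChart e (twoPow (fundamentalForm g hg) n) y
      (ContinuousAlternatingMap.interleave b fun a ↦ Complex.I • b a) := by
  rw [inChart_twoPow]
  refine twoPow_interleave_basis_pos b _ (fun u v ↦ ?_) (fun u hu ↦ ?_)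
  · rw [inChart_fundamentalForm g hg he hy, inChart_fundamentalForm g hg he hy,
      metricInChart_I_smul g hg he hy]
  · rw [inChart_fundamentalForm g hg he hy, metricInChart_I_smul g hg he hy]
    exact metricInChart_pos g he hy hu

lemma twoPow_fundamentalForm_notMem_exactForms [FiniteDimensional ℂ E] [T2Space X] [CompactSpace X]
    [Nonempty X] (hd : extD (fundamentalForm g hg) = 0) {k : ℕ} (hk : k ≤ finrank ℂ E) :
    twoPow (fundamentalForm g hg) k ∉ exactForms E X (2 * k) := by
  have hs := isSmooth_fundamentalForm g hg
  set η := fundamentalForm g hg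
  intro hmem
  cases k with
  | zero =>
    obtain ⟨x⟩ := ‹Nonempty X›
    -- In degree `0` the exact forms are `⊥`, while the zeroth power is the constant `1`.
    have h0 : twoPow η 0 = 0 := hmem
    have h1 : (twoPow η 0).toFun x ![] = 0 := by rw [h0]; rfl
    exact one_ne_zero h1
  | succ j =>
    -- If `η ^ (m + 1) = dβ` up to positive factors, then `η ∧ β` is, up to such a factor, a
    -- primitive of the next power; this climbs to top degree.
    have hstep (m : ℕ) (hm : j ≤ m) : ∃ β : RawForm E X (2 * m + 1), IsSmooth β ∧
        extD β = twoPow η (m + 1) := by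
      induction m, hm using Nat.le_induction with
      | base => exact hmem
      | succ m _ ih =>
        obtain ⟨β, hβ, hβ'⟩ := ih
        exact ⟨twoMul η β, hs.twoMul hβ, (extD_twoMul hs hd hβ).trans (by rw [hβ']; rfl)⟩
    obtain ⟨m, hm⟩ : ∃ m, finrank ℂ E = m + 1 := Nat.exists_eq_add_of_le' (by omega)
    obtain ⟨β, hβ, hβ'⟩ := hstep m (by omega)
    refine not_forall_inChart_extD_pos isOrientedAtlas (k := 2 * m + 1) ?_ hβ
      (ContinuousAlternatingMap.interleave (finBasisOfFinrankEq ℂ E hm) fun a ↦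
        Complex.I • finBasisOfFinrankEq ℂ E hm a) fun e he y hy ↦ ?_
    · rw [finrank_real_of_complex, hm]
      ring
    · rw [hβ']
      exact inChart_twoPow_fundamentalForm_pos g hg _ he hy

end Kahler

end

theorem mainTheorem7 {E : Type*} [NormedAddCommGroup E] [NormedSpace ℂ E] [FiniteDimensional ℂ E]
    {X : Type*} [TopologicalSpace X] [T2Space X] [CompactSpace X] [Nonempty X]
    [ChartedSpace E X] [IsManifold 𝓘(ℂ, E) ω X]
    (n : ℕ) (hn : Module.finrank ℂ E = n)
    (hX : ∃ g : Kahler.RiemannianMetric E X, Kahler.IsKahler g) :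
    ∀ k ≤ n, Nontrivial (DeRham.Cohomology E X (2 * k)) := by
  intro k hk
  obtain ⟨g, hg, hd⟩ := hX
  have hs := Kahler.isSmooth_fundamentalForm g hg
  refine Submodule.Quotient.nontrivial_iff.2 fun htop ↦ ?_
  refine Kahler.twoPow_fundamentalForm_notMem_exactForms g hg hd (hk.trans hn.ge) ?_
  let c : DeRham.closedForms E X (2 * k) :=
    ⟨DeRham.twoPow (Kahler.fundamentalForm g hg) k, hs.twoPow k, DeRham.extD_twoPow hs hd k⟩
  have hc : c ∈ (DeRham.exactForms E X (2 * k)).submoduleOf (DeRham.closedForms E X (2 * k)) := by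
    rw [htop]
    trivial
  exact hc
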